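/- Let $G$ be a torsion-free lacunary hyperbolic group and let $g\in G$ be an element of infinite order. Put $$E^{\mathcal L}(g)=\{x\in G : x g^{n}x^{-1}=g^{n}\ \text{or}\ x g^{n}x^{-1}=g^{-n}\ \text{for some integer } n=n(x)\ge 1\},$$ which is a subgroup of $G$. Then $E^{\mathcal L}(g)$ is an abelian group of rank $1$, and it embeds in $(\mathbb Q,+)$. Here a finitely generated group $G$ is called lacunary hyperbolic if it is (isomorphic to) the direct limit of a sequence of groups and epimorphisms $$G_1\xrightarrow{\ \eta_1\ }G_2\xrightarrow{\ \eta_2\ }G_3\xrightarrow{\ \eta_3\ }\cdots$$ such that each $G_i$ is generated by a finite set $S_i$, $\eta_i(S_i)=S_{i+1}$, each $G_i$ is $\delta_i$-hyperbolic (in the sense of Gromov) for the word metric of $S_i$, and $\delta_i=o(r_i)$, where $r_i\in\mathbb N\cup\{\infty\}$ is the injectivity radius of $\eta_i$, i.e. the radius of the largest ball around the identity of $G_i$ in the word metric of $S_i$ on which $\eta_i$ is injective ($r_i=\infty$ if $\eta_i$ is injective). -/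

import Mathlib

open scoped NNReal ENNReal

universe u

/-- The word metric on the group `G` with respect to a generating set `S`: the distance in the
Cayley graph, whose edges join `g` and `g * s` for `s ∈ S`. -/
noncomputable def wordDist {G : Type u} [Group G] (S : Set G) (x y : G) : ℕ :=
  (SimpleGraph.mulCayley S).dist x y

/-- `G`, with the word metric of the generating set `S`, is a `δ`-hyperbolic metric space in the
sense of Gromov (four point condition, which is the inequality
`(x|z)_w ≥ min ((x|y)_w) ((y|z)_w) - δ` for Gromov products). -/
def IsHyperbolicWith {G : Type u} [Group G] (S : Set G) (δ : ℝ≥0) : Prop :=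
  ∀ x y z w : G,
    (wordDist S x z : ℝ) + wordDist S y w ≤
      max ((wordDist S x y : ℝ) + wordDist S z w) ((wordDist S y z : ℝ) + wordDist S x w) + 2 * δ

/-- The injectivity radius of `α : G →* H` with respect to the generating set `S` of `G`: the
largest radius of a ball around `1` on which `α` is injective (`⊤` if `α` is injective). -/
noncomputable def injectivityRadius {G H : Type u} [Group G] [Group H] (S : Set G)
    (α : G →* H) : ℕ∞ :=
  sSup {r : ℕ∞ | ∃ n : ℕ, r = n ∧ Set.InjOn α {x : G | wordDist S 1 x ≤ n}}

/-- Lacunary hyperbolic groups: finitely generated direct limits of sequences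
`H 0 → H 1 → H 2 → ⋯` of groups and epimorphisms, where `H i` is generated by a finite set `S i`,
the map `H i → H (i + 1)` takes `S i` onto `S (i + 1)`, each `H i` is `δ i`-hyperbolic with respect
to `S i`, and `δ i = o(r i)` with `r i` the injectivity radius of `H i → H (i + 1)`. The sequence
is given with all its composite maps `f i j : H i → H j`, as a directed system indexed by `ℕ`. -/
def IsLacunaryHyperbolic (G : Type u) [Group G] : Prop :=
  Group.FG G ∧
  ∃ (H : ℕ → Type u) (_ : ∀ i, Group (H i)) (f : ∀ i j, i ≤ j → H i →* H j)
    (_ : DirectedSystem H (fun i j h ↦ f i j h))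
    (S : ∀ i, Set (H i)) (δ : ℕ → ℝ≥0),
    Nonempty (G ≃* DirectLimit H f) ∧
    (∀ i, Function.Surjective (f i (i + 1) i.le_succ)) ∧
    (∀ i, (S i).Finite) ∧
    (∀ i, Subgroup.closure (S i) = ⊤) ∧
    (∀ i, f i (i + 1) i.le_succ '' S i = S (i + 1)) ∧
    (∀ i, IsHyperbolicWith (S i) (δ i)) ∧
    ∀ ε : ℝ≥0, 0 < ε → ∀ᶠ i in Filter.atTop,
      (δ i : ℝ≥0∞) ≤ ε * (injectivityRadius (S i) (f i (i + 1) i.le_succ) : ℝ≥0∞)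

/-- The subgroup `E^L(g)` of all `x` with `x g ^ n x⁻¹ = g ^ (± n)` for some `n ≥ 1`. -/
def elementarySubgroup {G : Type u} [Group G] (g : G) : Subgroup G where
  carrier := {x | ∃ n : ℕ, 0 < n ∧ (x * g ^ n * x⁻¹ = g ^ n ∨ x * g ^ n * x⁻¹ = (g ^ n)⁻¹)}
  one_mem' := ⟨1, one_pos, Or.inl (by simp)⟩
  mul_mem' := by
    have key : ∀ (x : G) (n m : ℕ),
        (x * g ^ n * x⁻¹ = g ^ n ∨ x * g ^ n * x⁻¹ = (g ^ n)⁻¹) →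
        (x * g ^ (n * m) * x⁻¹ = g ^ (n * m) ∨ x * g ^ (n * m) * x⁻¹ = (g ^ (n * m))⁻¹) := by
      intro x n m h
      rw [pow_mul, ← conj_pow]
      rcases h with h | h <;> rw [h]
      · exact Or.inl rfl
      · exact Or.inr (inv_pow _ _)
    rintro x y ⟨n, hn, hx⟩ ⟨m, hm, hy⟩
    refine ⟨n * m, Nat.mul_pos hn hm, ?_⟩
    have hx' := key x n m hx
    have hy' := key y m n hy
    rw [mul_comm m n] at hy'
    have e : x * y * g ^ (n * m) * (x * y)⁻¹ = x * (y * g ^ (n * m) * y⁻¹) * x⁻¹ := by group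
    rw [e]
    rcases hy' with hy' | hy' <;> rw [hy']
    · exact hx'
    · rw [← conj_inv]
      rcases hx' with hx' | hx' <;> rw [hx']
      · exact Or.inr rfl
      · exact Or.inl (inv_inv _)
  inv_mem' := by
    rintro x ⟨n, hn, hx⟩
    refine ⟨n, hn, ?_⟩
    rcases hx with hx | hx
    · left
      calc x⁻¹ * g ^ n * x⁻¹⁻¹ = x⁻¹ * (x * g ^ n * x⁻¹) * x⁻¹⁻¹ := by rw [hx]
        _ = g ^ n := by group
    · right
      calc x⁻¹ * g ^ n * x⁻¹⁻¹ = x⁻¹ * (x * g ^ n * x⁻¹)⁻¹ * x⁻¹⁻¹ := by rw [hx, inv_inv (g ^ n)]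
        _ = (g ^ n)⁻¹ := by simp [mul_assoc]

/-- The group `A` is abelian and, as a `ℤ`-module, has rank one. -/
def IsAbelianOfRankOne (A : Type u) [Group A] : Prop :=
  ∃ h : ∀ x y : A, x * y = y * x,
    letI : CommGroup A := { mul_comm := h }
    Module.rank ℤ (Additive A) = 1

/-!
Torsion-free direct limits of hyperbolic groups have locally cyclic elementary subgroups, and this
is what is proved here: of the definition of a lacunary hyperbolic group only the hyperbolicity of
the groups `H i` and the finiteness of the `S i` are used. Two elements `x`, `y` of `E^L(g)` and the
relations saying that they commute with a power `g ^ N` lift to some `H i`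
(`IsLacunaryHyperbolic.exists_lift`), so it suffices to understand, in a `δ`-hyperbolic group,
the centralizer of an element `h` of infinite order.

* Some power of `h` is hyperbolic: `d(p, h^n p) + 4δ < d(p, h^{2n} p)` for some `p` and `n > 0`
  (`IsHyperbolicWith.exists_pow_hyperbolic`). The powers `h ^ i` with `i` small translate a long
  geodesic from `1` to `h ^ m` along itself, up to `O(δ)`. If the translation length is large
  compared to `δ`, then `h ^ i` is hyperbolic at the midpoint; otherwise many powers of `h` move the
  midpoint by `O(δ)`, against the finiteness of balls.
* If `|k| + 4δ < |k²|` and `z` commutes with `k`, then a shortest element of the coset `⟨k⟩z` has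
  length at most `|k|`, by the four point condition for `1, k, k², kz` and for `1, z, kz, k`
  (`IsHyperbolicWith.exists_zpow_mul_le`). So `⟨k⟩` has finite index in its centralizer.
* A group whose centre has finite index has torsion commutators, since the transfer to the centre is
  a power map.

Mapping this to the torsion-free group `G`, elements commuting with a power of `g` commute with each
other and have a power in `⟨g⟩` (`IsLacunaryHyperbolic.commute_and_exists_pow_eq_zpow`). It follows
that no element inverts a power of `g`, that `E^L(g)` is abelian, and that `x ↦ b / a`, where
`x ^ a = g ^ b`, embeds it in `ℚ`.
-/

open scoped commutatorElement

/-! ### The word metric -/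

section WordMetric

variable {H : Type u} [Group H] {S : Set H}

theorem wordDist_self (x : H) : wordDist S x x = 0 := SimpleGraph.dist_self

theorem wordDist_comm (x y : H) : wordDist S x y = wordDist S y x := SimpleGraph.dist_comm

theorem wordDist_mul_left (a x y : H) : wordDist S (a * x) (a * y) = wordDist S x y := by
  have key : ∀ b u v : H, (SimpleGraph.mulCayley S).edist (b * u) (b * v) ≤
      (SimpleGraph.mulCayley S).edist u v := by
    intro b u v
    by_cases hr : (SimpleGraph.mulCayley S).Reachable u v
    · obtain ⟨w, hw⟩ := hr.exists_walk_length_eq_edist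
      let φ : SimpleGraph.mulCayley S →g SimpleGraph.mulCayley S :=
        ⟨fun t ↦ b * t, fun h ↦ SimpleGraph.mulCayley_adj_mul_iff_right.2 h⟩
      rw [← hw, ← SimpleGraph.Walk.length_map φ w]
      exact SimpleGraph.edist_le (w.map φ)
    · rw [SimpleGraph.edist_eq_top_of_not_reachable hr]
      exact le_top
  unfold wordDist SimpleGraph.dist
  congr 1
  refine le_antisymm (key a x y) ?_
  simpa using key a⁻¹ (a * x) (a * y)

theorem wordDist_eq_one_inv_mul (x y : H) : wordDist S x y = wordDist S 1 (x⁻¹ * y) := by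
  rw [← wordDist_mul_left x⁻¹ x y, inv_mul_cancel]

theorem mulCayley_reachable_one (hS : Subgroup.closure S = ⊤) (x : H) :
    (SimpleGraph.mulCayley S).Reachable 1 x := by
  have hx : x ∈ Subgroup.closure S := hS ▸ Subgroup.mem_top x
  have step : ∀ (y s : H), s ∈ S → (SimpleGraph.mulCayley S).Reachable y (y * s) := by
    intro y s hs
    by_cases h : y = y * s
    · rw [← h]
    · exact SimpleGraph.Adj.reachable ((SimpleGraph.mulCayley_adj S _ _).2 ⟨h, by simp [hs]⟩)
  induction hx using Subgroup.closure_induction_right with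
  | one => exact SimpleGraph.Reachable.refl _
  | mul_right y _ s hs ih => exact ih.trans (step y s hs)
  | mul_inv_cancel y _ s hs ih =>
    exact ih.trans (by simpa using (step (y * s⁻¹) s hs).symm)

theorem mulCayley_connected (hS : Subgroup.closure S = ⊤) :
    (SimpleGraph.mulCayley S).Connected :=
  ⟨fun x y ↦ (mulCayley_reachable_one hS x).symm.trans (mulCayley_reachable_one hS y)⟩

theorem wordDist_triangle (hS : Subgroup.closure S = ⊤) (x y z : H) :
    wordDist S x z ≤ wordDist S x y + wordDist S y z :=
  (mulCayley_connected hS).dist_triangle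

/-- The Cayley graph is geodesic. -/
theorem exists_wordDist_eq_of_le (hS : Subgroup.closure S = ⊤) (x y : H) {k : ℕ}
    (hk : k ≤ wordDist S x y) :
    ∃ p, wordDist S x p = k ∧ k + wordDist S p y = wordDist S x y := by
  obtain ⟨w, hw⟩ := (mulCayley_connected hS).exists_walk_length_eq_dist x y
  have h1 : wordDist S x (w.getVert k) ≤ k :=
    (SimpleGraph.dist_le (w.take k)).trans (by simp)
  have h2 : wordDist S (w.getVert k) y ≤ wordDist S x y - k :=
    (SimpleGraph.dist_le (w.drop k)).trans (by simp [hw, wordDist])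
  have h3 := wordDist_triangle hS x (w.getVert k) y
  exact ⟨w.getVert k, by omega, by omega⟩

theorem finite_setOf_wordDist_one_le (hfin : S.Finite) (hS : Subgroup.closure S = ⊤) (n : ℕ) :
    {x : H | wordDist S 1 x ≤ n}.Finite := by
  induction n with
  | zero =>
    refine (Set.finite_singleton (1 : H)).subset fun x hx ↦ ?_
    have := ((mulCayley_connected hS).dist_eq_zero_iff (u := 1) (v := x)).1 (Nat.le_zero.1 hx)
    exact this.symm
  | succ n ih =>
    refine (ih.union (ih.mul (hfin.union hfin.inv))).subset fun x hx ↦ ?_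
    rcases Nat.lt_or_ge n (wordDist S 1 x) with hlt | hle
    · right
      obtain ⟨p, hp, hpx⟩ := exists_wordDist_eq_of_le hS 1 x hlt.le
      have hx' : wordDist S 1 x ≤ n + 1 := hx
      have h1 : wordDist S p x = 1 := by omega
      have hadj := ((SimpleGraph.mulCayley_adj S _ _).1 (SimpleGraph.dist_eq_one_iff_adj.1 h1)).2
      refine Set.mem_mul.2 ⟨p, hp.le, p⁻¹ * x, ?_, by group⟩
      rcases hadj with h | h
      · exact Or.inl h
      · exact Or.inr (by simpa using h)
    · exact Or.inl hle

theorem finite_setOf_wordDist_one_le_real (hfin : S.Finite) (hS : Subgroup.closure S = ⊤)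
    (r : ℝ) : {x : H | (wordDist S 1 x : ℝ) ≤ r}.Finite :=
  (finite_setOf_wordDist_one_le hfin hS ⌈r⌉₊).subset fun _ hx ↦
    Nat.cast_le.1 (le_trans hx (Nat.le_ceil r))

theorem IsHyperbolicWith.four_point {δ : ℝ≥0} (hδ : IsHyperbolicWith S δ) (x y z w : H) :
    (wordDist S x z : ℝ) + wordDist S y w ≤ wordDist S x y + wordDist S z w + 2 * δ ∨
      (wordDist S x z : ℝ) + wordDist S y w ≤ wordDist S y z + wordDist S x w + 2 * δ := by
  have h := hδ x y z w
  rcases max_cases ((wordDist S x y : ℝ) + wordDist S z w)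
    ((wordDist S y z : ℝ) + wordDist S x w) with ⟨h1, -⟩ | ⟨h1, -⟩ <;> rw [h1] at h
  · exact Or.inl h
  · exact Or.inr h

end WordMetric

/-! ### Centralizers of hyperbolic elements -/

section Centralizer

variable {H : Type u} [Group H] {S : Set H} {δ : ℝ≥0}

/-- The coset `⟨k⟩z` of an element `z` commuting with `k` meets the ball of radius `|k|`, provided
that `k` translates the base point by a hyperbolic displacement, `|k| + 4δ < |k²|`. -/
theorem IsHyperbolicWith.exists_zpow_mul_le (hδ : IsHyperbolicWith S δ) {k z : H}
    (hk : (wordDist S 1 k : ℝ) + 4 * δ < wordDist S 1 (k ^ 2)) (hz : Commute k z) :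
    ∃ n : ℤ, wordDist S 1 (k ^ n * z) ≤ wordDist S 1 k := by
  obtain ⟨n, hn⟩ : ∃ n : ℤ, ∀ m : ℤ, wordDist S 1 (k ^ n * z) ≤ wordDist S 1 (k ^ m * z) :=
    ⟨Function.argmin fun n : ℤ ↦ wordDist S 1 (k ^ n * z), fun m ↦
      Function.argmin_le (fun n : ℤ ↦ wordDist S 1 (k ^ n * z)) m⟩
  refine ⟨n, ?_⟩
  by_contra! hlt
  have hup : wordDist S 1 (k ^ n * z) ≤ wordDist S 1 (k * (k ^ n * z)) := by
    have := hn (1 + n)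
    rwa [zpow_add, zpow_one, mul_assoc] at this
  have hdown : wordDist S 1 (k ^ n * z) ≤ wordDist S k (k ^ n * z) := by
    have := hn (-1 + n)
    rwa [zpow_add, zpow_neg_one, mul_assoc, ← wordDist_eq_one_inv_mul] at this
  have hw : Commute k (k ^ n * z) := ((Commute.refl k).zpow_right n).mul_right hz
  generalize k ^ n * z = w at *
  have e1 : wordDist S k (k * w) = wordDist S 1 w := by
    simpa using wordDist_mul_left (S := S) k 1 w
  have e2 : wordDist S k (k ^ 2) = wordDist S 1 k := by
    simpa [sq] using wordDist_mul_left (S := S) k 1 k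
  have e3 : wordDist S (k ^ 2) (k * w) = wordDist S k w := by
    rw [sq, wordDist_mul_left]
  have e4 : wordDist S w (k * w) = wordDist S 1 k := by
    rw [hw.eq]
    simpa using wordDist_mul_left (S := S) w 1 k
  have e5 : wordDist S (k * w) k = wordDist S 1 w := by rw [wordDist_comm, e1]
  -- With `w` shortest in its coset, `f2` gives `|k * w|, |k⁻¹ * w| ≤ |w| + 2δ`, and then `f1` gives
  -- `|k ^ 2| ≤ |k| + 4δ`.
  have f1 := hδ.four_point 1 k (k ^ 2) (k * w)
  have f2 := hδ.four_point 1 w (k * w) k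
  rw [e1, e2, e3] at f1
  rw [e4, e5, wordDist_comm w k] at f2
  have hlt' : (wordDist S 1 k : ℝ) < wordDist S 1 w := by exact_mod_cast hlt
  have hup' : (wordDist S 1 w : ℝ) ≤ wordDist S 1 (k * w) := by exact_mod_cast hup
  have hdown' : (wordDist S 1 w : ℝ) ≤ wordDist S k w := by exact_mod_cast hdown
  rcases f1 with f1 | f1 <;> rcases f2 with f2 | f2 <;> linarith

theorem IsHyperbolicWith.finiteIndex_zpowers_subgroupOf_centralizer (hδ : IsHyperbolicWith S δ)
    (hfin : S.Finite) (hS : Subgroup.closure S = ⊤) {k : H}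
    (hk : (wordDist S 1 k : ℝ) + 4 * δ < wordDist S 1 (k ^ 2)) :
    ((Subgroup.zpowers k).subgroupOf (Subgroup.centralizer {k})).FiniteIndex := by
  let F := {x : Subgroup.centralizer {k} | wordDist S 1 (x : H) ≤ wordDist S 1 k}
  have hF : F.Finite := (finite_setOf_wordDist_one_le hfin hS (wordDist S 1 k)).preimage
    Subtype.val_injective.injOn
  have : Finite F := hF
  have hsurj : Function.Surjective fun x : F ↦
      (QuotientGroup.mk x.1 : Subgroup.centralizer {k} ⧸
        (Subgroup.zpowers k).subgroupOf (Subgroup.centralizer {k})) := by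
    intro q
    obtain ⟨z, rfl⟩ := QuotientGroup.mk_surjective q
    have hz : Commute k z := (Subgroup.mem_centralizer_singleton_iff.1 z.2).symm
    obtain ⟨n, hn⟩ := hδ.exists_zpow_mul_le hk hz
    have hkC : k ∈ Subgroup.centralizer {k} := Subgroup.mem_centralizer_singleton_iff.2 rfl
    refine ⟨⟨⟨k, hkC⟩ ^ n * z, by simpa [F] using hn⟩, ?_⟩
    refine QuotientGroup.eq.2 ?_
    rw [Subgroup.mem_subgroupOf, Subgroup.mem_zpowers_iff]
    refine ⟨-n, ?_⟩
    have := (hz.zpow_left (-n)).eq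
    simp only [zpow_neg] at this
    simp [mul_assoc, this]
  have := Finite.of_surjective _ hsurj
  exact Subgroup.finiteIndex_of_finite_quotient

end Centralizer

/-- A weak form of Schur's theorem: the transfer to the centre, `x ↦ x ^ [C : Z(C)]`, kills
commutators. -/
theorem isOfFinOrder_commutatorElement_of_finiteIndex_center {C : Type*} [Group C]
    [(Subgroup.center C).FiniteIndex] (x y : C) : IsOfFinOrder ⁅x, y⁆ := by
  refine isOfFinOrder_iff_pow_eq_one.2 ⟨(Subgroup.center C).index,
    Nat.pos_of_ne_zero Subgroup.FiniteIndex.index_ne_zero, ?_⟩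
  have h : MonoidHom.transferCenterPow C ⁅x, y⁆ = 1 := by
    rw [map_commutatorElement, commutatorElement_eq_one_iff_mul_comm]
    exact Subtype.ext (Subgroup.mem_center_iff.1 (MonoidHom.transferCenterPow C y).2 _)
  exact congrArg Subtype.val h

theorem exists_pow_eq_zpow_and_isOfFinOrder_commutatorElement {H : Type*} [Group H] {k x y : H}
    (hfi : ((Subgroup.zpowers k).subgroupOf (Subgroup.centralizer {k})).FiniteIndex)
    (hx : Commute x k) (hy : Commute y k) :
    (∃ a : ℕ, 0 < a ∧ ∃ b : ℤ, x ^ a = k ^ b) ∧ IsOfFinOrder ⁅x, y⁆ := by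
  have hxC : x ∈ Subgroup.centralizer {k} := Subgroup.mem_centralizer_singleton_iff.2 hx.eq
  have hyC : y ∈ Subgroup.centralizer {k} := Subgroup.mem_centralizer_singleton_iff.2 hy.eq
  constructor
  · obtain ⟨a, ha, -, h⟩ := Subgroup.exists_pow_mem_of_index_ne_zero hfi.index_ne_zero ⟨x, hxC⟩
    rw [Subgroup.mem_subgroupOf, Subgroup.mem_zpowers_iff] at h
    obtain ⟨b, hb⟩ := h
    exact ⟨a, ha, b, by simpa using hb.symm⟩
  · have hle : (Subgroup.zpowers k).subgroupOf (Subgroup.centralizer {k}) ≤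
        Subgroup.center (Subgroup.centralizer {k}) := by
      intro z hz
      rw [Subgroup.mem_subgroupOf, Subgroup.mem_zpowers_iff] at hz
      obtain ⟨n, hn⟩ := hz
      refine Subgroup.mem_center_iff.2 fun w ↦ Subtype.ext ?_
      have hw : Commute (w : H) k := Subgroup.mem_centralizer_singleton_iff.1 w.2
      simpa [← hn] using (hw.zpow_right n).eq
    have : (Subgroup.center (Subgroup.centralizer {k})).FiniteIndex :=
      Subgroup.finiteIndex_of_le hle
    have h := isOfFinOrder_commutatorElement_of_finiteIndex_center
      (⟨x, hxC⟩ : Subgroup.centralizer {k}) ⟨y, hyC⟩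
    simpa using (Subgroup.centralizer {k}).subtype.isOfFinOrder h

/-! ### Elements of infinite order -/

section InfiniteOrder

variable {H : Type u} [Group H] {S : Set H} {δ : ℝ≥0}

/-- Two points near a geodesic from `A` to `B` are about as far apart as their distances from
`A` differ. -/
theorem IsHyperbolicWith.wordDist_le_abs_sub (hδ : IsHyperbolicWith S δ) {A B x y : H} {e : ℝ}
    (hx : (wordDist S A x : ℝ) + wordDist S x B ≤ wordDist S A B + e)
    (hy : (wordDist S A y : ℝ) + wordDist S y B ≤ wordDist S A B + e) :
    (wordDist S x y : ℝ) ≤ |(wordDist S A y : ℝ) - wordDist S A x| + e + 2 * δ := by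
  have h := hδ.four_point x A y B
  rw [wordDist_comm x A] at h
  have h1 := le_abs_self ((wordDist S A y : ℝ) - wordDist S A x)
  have h2 := neg_abs_le ((wordDist S A y : ℝ) - wordDist S A x)
  rcases h with h | h <;> linarith

/-- An isometry moving `A`, `B` by at most `c` to `A'`, `B'` takes a point `x` near the middle of a
geodesic from `A` to `B` to a point `x'` near this geodesic, shifted by
`d(A, B') - d(A, B)` along it. -/
theorem IsHyperbolicWith.shift_along_geodesic (hδ : IsHyperbolicWith S δ)
    (hS : Subgroup.closure S = ⊤) {A B A' B' x x' : H} {c e : ℝ}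
    (hA : wordDist S A' x' = wordDist S A x) (hB : wordDist S x' B' = wordDist S x B)
    (hAB : wordDist S A' B' = wordDist S A B)
    (hAc : (wordDist S A A' : ℝ) ≤ c) (hBc : (wordDist S B B' : ℝ) ≤ c)
    (he : (wordDist S A x : ℝ) + wordDist S x B ≤ wordDist S A B + e)
    (hmid : |(wordDist S A x : ℝ) - wordDist S x B| + 4 * c + 2 * δ < wordDist S A B) :
    (wordDist S A x' : ℝ) + wordDist S x' B ≤ wordDist S A x + wordDist S x B + 4 * δ ∧
    (wordDist S A x' : ℝ) ≤ wordDist S A x + (wordDist S A B' - wordDist S A B) + 2 * δ ∧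
    (wordDist S A x : ℝ) + (wordDist S A B' - wordDist S A B) - e - 2 * δ ≤ wordDist S A x' := by
  have tri : ∀ u v w : H, (wordDist S u w : ℝ) ≤ wordDist S u v + wordDist S v w :=
    fun u v w ↦ by exact_mod_cast wordDist_triangle hS u v w
  have h1 := le_abs_self ((wordDist S A x : ℝ) - wordDist S x B)
  have h2 := neg_abs_le ((wordDist S A x : ℝ) - wordDist S x B)
  have hA' : (wordDist S A' x' : ℝ) = wordDist S A x := by exact_mod_cast hA
  have hB' : (wordDist S x' B' : ℝ) = wordDist S x B := by exact_mod_cast hB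
  have hAB' : (wordDist S A' B' : ℝ) = wordDist S A B := by exact_mod_cast hAB
  have t1 := tri A' A x'
  have t2 := tri x' B B'
  have t3 := tri A A' x'
  have t4 := tri A B' B
  have t5 := tri A x' B
  rw [wordDist_comm A' A] at t1
  rw [wordDist_comm B' B] at t4
  have hc : (0 : ℝ) ≤ c := (Nat.cast_nonneg _).trans hAc
  -- In both uses of the four point condition below, `hmid` excludes the second alternative.
  have f1 : (wordDist S A x' : ℝ) ≤
      wordDist S A x + (wordDist S A B' - wordDist S A B) + 2 * δ := by
    have h := hδ.four_point A A' x' B'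
    rcases h with h | h <;> linarith
  have f2 : (wordDist S x' B : ℝ) ≤
      wordDist S x B - (wordDist S A B' - wordDist S A B) + 2 * δ := by
    have h := hδ.four_point x' A B B'
    rw [wordDist_comm x' A] at h
    rcases h with h | h <;> linarith
  exact ⟨by linarith, f1, by linarith⟩

/-- A point `p` in the middle of a geodesic from `1` to `b` is moved by at most `28δ` by every
`f` commuting with `b` which is short compared to `b`, unless `f` is hyperbolic at `p`. -/
theorem IsHyperbolicWith.wordDist_mul_midpoint_le (hδ : IsHyperbolicWith S δ)
    (hS : Subgroup.closure S = ⊤) {b f p : H} {c : ℝ} (hf : Commute f b)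
    (hfc : (wordDist S 1 f : ℝ) ≤ c) (hb : 1 + 6 * c + 2 * δ < wordDist S 1 b)
    (hp : wordDist S 1 p + wordDist S p b = wordDist S 1 b)
    (hmid : |(wordDist S 1 p : ℝ) - wordDist S p b| ≤ 1)
    (hnot : (wordDist S p (f ^ 2 * p) : ℝ) ≤ wordDist S p (f * p) + 4 * δ) :
    (wordDist S p (f * p) : ℝ) ≤ 28 * δ := by
  have tri : ∀ u v w : H, (wordDist S u w : ℝ) ≤ wordDist S u v + wordDist S v w :=
    fun u v w ↦ by exact_mod_cast wordDist_triangle hS u v w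
  have hp' : (wordDist S 1 p : ℝ) + wordDist S p b = wordDist S 1 b := by exact_mod_cast hp
  have hbb : wordDist S b (f * b) = wordDist S 1 f := by
    rw [hf.eq]
    simpa using wordDist_mul_left (S := S) b 1 f
  have hmul : ∀ u : H, wordDist S f (f * u) = wordDist S 1 u := fun u ↦ by
    simpa using wordDist_mul_left (S := S) f 1 u
  have hc : (0 : ℝ) ≤ c := (Nat.cast_nonneg _).trans hfc
  have hδ0 : (0 : ℝ) ≤ δ := δ.2
  obtain ⟨a1, a2, a3⟩ := hδ.shift_along_geodesic hS (A := 1) (B := b) (A' := f) (B' := f * b)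
    (x := p) (x' := f * p) (c := c) (e := 0) (hmul p) (wordDist_mul_left f p b) (hmul b) hfc
    (by rw [hbb]; exact hfc) (by linarith) (by linarith)
  have hmid' : |(wordDist S 1 (f * p) : ℝ) - wordDist S (f * p) b| ≤ 1 + 2 * c := by
    have t1 := tri 1 f (f * p)
    have t2 := tri f 1 (f * p)
    have t3 := tri (f * p) (f * b) b
    have t4 := tri (f * p) b (f * b)
    rw [wordDist_comm f 1] at t2
    rw [wordDist_comm (f * b) b, wordDist_mul_left, hbb] at t3
    rw [wordDist_mul_left, hbb] at t4
    rw [hmul] at t1 t2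
    rw [abs_le] at hmid ⊢
    constructor <;> linarith [hmid.1, hmid.2]
  obtain ⟨b1, b2, b3⟩ := hδ.shift_along_geodesic hS (A := 1) (B := b) (A' := f) (B' := f * b)
    (x := f * p) (x' := f ^ 2 * p) (c := c) (e := 4 * δ) (by rw [sq, mul_assoc, hmul])
    (by rw [sq, mul_assoc, wordDist_mul_left]) (hmul b) hfc
    (by rw [hbb]; exact hfc) (by linarith) (by linarith)
  have hclose := hδ.wordDist_le_abs_sub (A := 1) (B := b) (x := p) (y := f * p) (e := 4 * δ)
    (by linarith) (by linarith)
  have t1 := tri 1 p (f ^ 2 * p)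
  have t2 := tri 1 (f ^ 2 * p) p
  rw [wordDist_comm (f ^ 2 * p) p] at t2
  generalize (wordDist S 1 (f * b) : ℝ) - wordDist S 1 b = σ at *
  -- `d(p, f²p) ≥ 2|σ| - 8δ` and `d(p, fp) ≤ |σ| + 8δ`, so `hnot` gives `|σ| ≤ 20δ`.
  rcases abs_cases ((wordDist S 1 (f * p) : ℝ) - wordDist S 1 p) with ⟨h, _⟩ | ⟨h, _⟩ <;>
    rw [h] at hclose <;> linarith

/-- There are no parabolic elements. If no power of `h` were hyperbolic at any point, a midpoint `p`
of a long geodesic from `1` to a power of `h` would be moved by at most `28δ` by more powers of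
`h` than the ball of radius `28δ` has elements. -/
theorem IsHyperbolicWith.exists_pow_hyperbolic (hδ : IsHyperbolicWith S δ) (hfin : S.Finite)
    (hS : Subgroup.closure S = ⊤) {h : H} (hh : ¬ IsOfFinOrder h) :
    ∃ (p : H) (n : ℕ), 0 < n ∧
      (wordDist S p (h ^ n * p) : ℝ) + 4 * δ < wordDist S p ((h ^ n) ^ 2 * p) := by
  by_contra! hnot
  have hinj : Function.Injective fun n : ℕ ↦ h ^ n := injective_pow_iff_not_isOfFinOrder.2 hh
  have hball := finite_setOf_wordDist_one_le_real hfin hS (28 * δ)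
  let F := hball.toFinset
  let c : ℕ := ∑ i ∈ Finset.range (F.card + 1), wordDist S 1 (h ^ i)
  obtain ⟨m, hm⟩ : ∃ m : ℕ, 1 + 6 * (c : ℝ) + 2 * δ < wordDist S 1 (h ^ m) := by
    by_contra! hle
    exact Set.infinite_range_of_injective hinj
      ((finite_setOf_wordDist_one_le_real hfin hS (1 + 6 * (c : ℝ) + 2 * δ)).subset
        (Set.range_subset_iff.2 hle))
  obtain ⟨p, hp1, hp2⟩ := exists_wordDist_eq_of_le hS 1 (h ^ m)
    (k := wordDist S 1 (h ^ m) / 2) (by omega)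
  have hmid : |(wordDist S 1 p : ℝ) - wordDist S p (h ^ m)| ≤ 1 := by
    have h1 : wordDist S 1 p ≤ wordDist S p (h ^ m) := by omega
    have h2 : wordDist S p (h ^ m) ≤ wordDist S 1 p + 1 := by omega
    have h1' : (wordDist S 1 p : ℝ) ≤ wordDist S p (h ^ m) := by exact_mod_cast h1
    have h2' : (wordDist S p (h ^ m) : ℝ) ≤ wordDist S 1 p + 1 := by exact_mod_cast h2
    rw [abs_le]
    constructor <;> linarith
  have hmaps : ∀ i ∈ Finset.range (F.card + 1), p⁻¹ * (h ^ i * p) ∈ F := by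
    intro i hi
    rw [Set.Finite.mem_toFinset, Set.mem_ofPred_eq, ← wordDist_eq_one_inv_mul]
    rcases Nat.eq_zero_or_pos i with rfl | hi0
    · rw [pow_zero, one_mul, wordDist_self, Nat.cast_zero]
      positivity
    · have hic : wordDist S 1 (h ^ i) ≤ c :=
        Finset.single_le_sum (f := fun i ↦ wordDist S 1 (h ^ i)) (fun _ _ ↦ Nat.zero_le _) hi
      exact hδ.wordDist_mul_midpoint_le hS (Commute.pow_pow_self h i m)
        (by exact_mod_cast hic) hm (by omega) hmid (hnot p i hi0)
  obtain ⟨i, -, j, -, hij, he⟩ :=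
    Finset.exists_ne_map_eq_of_card_lt_of_maps_to (by simp) hmaps
  exact hij (hinj (mul_right_cancel (mul_left_cancel he)))

/-- In a hyperbolic group, the elements commuting with a suitable power `h ^ n` of an element `h` of
infinite order are roots of powers of `h`, and their commutators are torsion. -/
theorem IsHyperbolicWith.exists_pow_forall_commute (hδ : IsHyperbolicWith S δ) (hfin : S.Finite)
    (hS : Subgroup.closure S = ⊤) {h : H} (hh : ¬ IsOfFinOrder h) :
    ∃ n : ℕ, 0 < n ∧ ∀ x y : H, Commute x (h ^ n) → Commute y (h ^ n) →
      (∃ a : ℕ, 0 < a ∧ ∃ b : ℤ, x ^ a = h ^ b) ∧ IsOfFinOrder ⁅x, y⁆ := by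
  obtain ⟨p, n, hn, hlt⟩ := hδ.exists_pow_hyperbolic hfin hS hh
  refine ⟨n, hn, fun x y hx hy ↦ ?_⟩
  -- Conjugation by `p` moves the base point to `p`.
  let φ : H ≃* H := MulAut.conj p⁻¹
  have hφ : ∀ t : H, φ t = p⁻¹ * (t * p) := fun t ↦ by simp [φ, mul_assoc]
  have hk : (wordDist S 1 (φ (h ^ n)) : ℝ) + 4 * δ < wordDist S 1 (φ (h ^ n) ^ 2) := by
    rw [← map_pow, hφ, hφ, ← wordDist_eq_one_inv_mul, ← wordDist_eq_one_inv_mul]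
    exact hlt
  obtain ⟨⟨a, ha, b, hb⟩, hcomm⟩ := exists_pow_eq_zpow_and_isOfFinOrder_commutatorElement
    (hδ.finiteIndex_zpowers_subgroupOf_centralizer hfin hS hk) (hx.map φ) (hy.map φ)
  constructor
  · refine ⟨a, ha, n * b, φ.injective ?_⟩
    rw [zpow_mul, zpow_natCast, map_pow, map_zpow, hb]
  · rw [← map_commutatorElement] at hcomm
    exact (Function.Injective.isOfFinOrder_iff (f := φ.toMonoidHom) φ.injective).1 hcomm

end InfiniteOrder

/-! ### Direct limits of hyperbolic groups -/

/-- Finitely many elements of a direct limit, with finitely many relations between them, lift to a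
finite stage of the system: here the relations say that `x` and `y` commute with `g ^ N`. -/
theorem IsLacunaryHyperbolic.exists_lift {G : Type u} [Group G] (hG : IsLacunaryHyperbolic G)
    {g x y : G} {N : ℕ} (hx : Commute x (g ^ N)) (hy : Commute y (g ^ N)) :
    ∃ (H : Type u) (_ : Group H) (S : Set H) (δ : ℝ≥0) (φ : H →* G) (g' x' y' : H),
      S.Finite ∧ Subgroup.closure S = ⊤ ∧ IsHyperbolicWith S δ ∧
      φ g' = g ∧ φ x' = x ∧ φ y' = y ∧ Commute x' (g' ^ N) ∧ Commute y' (g' ^ N) := by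
  obtain ⟨-, H, _, f, _, S, δ, ⟨e⟩, -, hfin, hS, -, hδ, -⟩ := hG
  let ι : ∀ i, H i →* G := fun i ↦ e.symm.toMonoidHom.comp
    (MonoidHom.mk' (fun a ↦ (⟦⟨i, a⟩⟧ : DirectLimit H f)) fun a b ↦
      (DirectLimit.mul_def (f := f) i a b).symm)
  have hmap : ∀ i j (h : i ≤ j) (a : H i), ι j (f i j h a) = ι i a := fun i j h a ↦
    congrArg e.symm (DirectLimit.mk_apply (f := fun i j h ↦ f i j h) i j a h)
  have hone : ∀ i (a : H i), ι i a = 1 → ∃ j, ∃ h : i ≤ j, f i j h a = 1 := fun i a ha ↦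
    (DirectLimit.exists_eq_one (f := f) ⟨i, a⟩).1 ((map_eq_one_iff e.symm e.symm.injective).1 ha)
  obtain ⟨i, g₀, x₀, y₀, hg₀, hx₀, hy₀⟩ := DirectLimit.exists_eq_mk₃ f (e g) (e x) (e y)
  have hg₁ : ι i g₀ = g := (congrArg e.symm hg₀.symm).trans (e.symm_apply_apply g)
  have hx₁ : ι i x₀ = x := (congrArg e.symm hx₀.symm).trans (e.symm_apply_apply x)
  have hy₁ : ι i y₀ = y := (congrArg e.symm hy₀.symm).trans (e.symm_apply_apply y)
  obtain ⟨j, hj, hxj⟩ := hone i ⁅x₀, g₀ ^ N⁆ (by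
    rw [map_commutatorElement, map_pow, hx₁, hg₁]
    exact commutatorElement_eq_one_iff_mul_comm.2 hx)
  obtain ⟨k, hk, hyk⟩ := hone i ⁅y₀, g₀ ^ N⁆ (by
    rw [map_commutatorElement, map_pow, hy₁, hg₁]
    exact commutatorElement_eq_one_iff_mul_comm.2 hy)
  have hxm : f i (max j k) (hj.trans (le_max_left j k)) ⁅x₀, g₀ ^ N⁆ = 1 := by
    rw [← DirectedSystem.map_map' (f := fun i j h ↦ f i j h) hj (le_max_left j k), hxj, map_one]
  have hym : f i (max j k) (hj.trans (le_max_left j k)) ⁅y₀, g₀ ^ N⁆ = 1 := by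
    rw [← DirectedSystem.map_map' (f := fun i j h ↦ f i j h) hk (le_max_right j k), hyk, map_one]
  rw [map_commutatorElement, map_pow] at hxm hym
  exact ⟨H (max j k), inferInstance, S _, δ _, ι _, _, _, _, hfin _, hS _, hδ _,
    (hmap _ _ _ _).trans hg₁, (hmap _ _ _ _).trans hx₁, (hmap _ _ _ _).trans hy₁,
    commutatorElement_eq_one_iff_mul_comm.1 hxm, commutatorElement_eq_one_iff_mul_comm.1 hym⟩

theorem IsLacunaryHyperbolic.commute_and_exists_pow_eq_zpow {G : Type u} [Group G]
    (hG : IsLacunaryHyperbolic G) (htf : ∀ x : G, IsOfFinOrder x → x = 1) {g x y : G}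
    (hg : ¬ IsOfFinOrder g) {N : ℕ} (hN : 0 < N) (hx : Commute x (g ^ N))
    (hy : Commute y (g ^ N)) :
    Commute x y ∧ ∃ a : ℕ, 0 < a ∧ ∃ b : ℤ, x ^ a = g ^ b := by
  obtain ⟨H, _, S, δ, φ, g', x', y', hfin, hS, hδ, rfl, rfl, rfl, hx', hy'⟩ := hG.exists_lift hx hy
  have hg' : ¬ IsOfFinOrder (g' ^ N) := fun h ↦ hg (φ.isOfFinOrder (h.of_pow hN.ne'))
  obtain ⟨n, -, h⟩ := hδ.exists_pow_forall_commute hfin hS hg'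
  obtain ⟨⟨a, ha, b, hab⟩, hcomm⟩ := h x' y' (hx'.pow_right n) (hy'.pow_right n)
  constructor
  · have := htf _ (φ.isOfFinOrder hcomm)
    rw [map_commutatorElement] at this
    exact commutatorElement_eq_one_iff_mul_comm.1 this
  · refine ⟨a, ha, N * b, ?_⟩
    rw [← map_pow, hab, map_zpow, map_pow, zpow_mul, zpow_natCast]

/-! ### The elementary subgroup -/

/-- Elements of `E^L(g)` centralize a power of `g`, and never invert one. If `x` inverts a power,
then, as `x ^ 2` centralizes that power, some `x ^ (2 * a)` is a power `g ^ b`. This commutes with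
`x`, but a power of it is inverted by `x`, so `b = 0` and `x` is torsion. -/
theorem IsLacunaryHyperbolic.commute_of_mem_elementarySubgroup {G : Type u} [Group G]
    (hG : IsLacunaryHyperbolic G) (htf : ∀ x : G, IsOfFinOrder x → x = 1) {g x : G}
    (hg : ¬ IsOfFinOrder g) (hx : x ∈ elementarySubgroup g) :
    ∃ n : ℕ, 0 < n ∧ Commute x (g ^ n) := by
  obtain ⟨n, hn, h | h⟩ := hx
  · exact ⟨n, hn, mul_inv_eq_iff_eq_mul.1 h⟩
  · exfalso
    have hinj : Function.Injective fun n : ℤ ↦ g ^ n := injective_zpow_iff_not_isOfFinOrder.2 hg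
    have hx2 : Commute (x ^ 2) (g ^ n) := by
      refine mul_inv_eq_iff_eq_mul.1 ?_
      calc x ^ 2 * g ^ n * (x ^ 2)⁻¹ = x * (x * g ^ n * x⁻¹) * x⁻¹ := by simp [sq, mul_assoc]
        _ = g ^ n := by rw [h, ← conj_inv, h, inv_inv]
    obtain ⟨-, a, ha, b, hab⟩ := hG.commute_and_exists_pow_eq_zpow htf hg hn hx2 hx2
    have hxb : Commute x (g ^ b) := hab ▸ ((Commute.refl x).pow_right 2).pow_right a
    have e1 : x * g ^ (n * b) * x⁻¹ = g ^ (n * b) := by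
      rw [mul_comm, zpow_mul]
      exact mul_inv_eq_iff_eq_mul.2 (hxb.zpow_right n).eq
    have e2 : x * g ^ (n * b) * x⁻¹ = g ^ (-(n * b)) := by
      rw [zpow_neg, zpow_mul, zpow_natCast, ← conj_zpow, h, inv_zpow]
    have hnb : (n : ℤ) * b = -(n * b) := hinj (e1.symm.trans e2)
    have hb : b = 0 := by
      have : (n : ℤ) * b = 0 := by omega
      rcases mul_eq_zero.1 this with h0 | h0
      · omega
      · exact h0
    rw [hb, zpow_zero, ← pow_mul] at hab
    have hx1 := htf x (isOfFinOrder_iff_pow_eq_one.2 ⟨2 * a, by omega, hab⟩)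
    rw [hx1, one_mul, inv_one, mul_one, ← zpow_natCast, ← zpow_neg] at h
    have : (n : ℤ) = -n := hinj h
    omega

/-- A torsion-free abelian group all of whose elements are roots of powers of `g` embeds in `ℚ`,
by `x ↦ b / a` where `x ^ a = g ^ b`. -/
theorem exists_injective_addMonoidHom_rat {A : Type*} [Group A] (hA : ∀ x y : A, x * y = y * x)
    (htf : ∀ x : A, IsOfFinOrder x → x = 1) {g : A} (hg : ¬ IsOfFinOrder g)
    (hroot : ∀ x : A, ∃ a : ℕ, 0 < a ∧ ∃ b : ℤ, x ^ a = g ^ b) :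
    ∃ φ : Additive A →+ ℚ, Function.Injective φ := by
  have hinj : Function.Injective fun n : ℤ ↦ g ^ n := injective_zpow_iff_not_isOfFinOrder.2 hg
  choose a ha b hab using hroot
  have ha' : ∀ x, (a x : ℚ) ≠ 0 := fun x ↦ Nat.cast_ne_zero.2 (ha x).ne'
  have hpow : ∀ x (n : ℕ), x ^ (a x * n) = g ^ (b x * n) := fun x n ↦ by
    rw [pow_mul, hab, zpow_mul, zpow_natCast]
  have hadd : ∀ x y, (b (x * y) : ℚ) / a (x * y) = b x / a x + b y / a y := by
    intro x y
    have h : b (x * y) * (a x * a y) = (b x * a y + b y * a x) * a (x * y) := by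
      apply hinj
      have hxy : Commute x y := hA x y
      calc g ^ (b (x * y) * (a x * a y)) = (x * y) ^ (a (x * y) * (a x * a y)) := by
            rw [hpow, Nat.cast_mul]
        _ = x ^ (a x * (a y * a (x * y))) * y ^ (a y * (a x * a (x * y))) := by
            rw [hxy.mul_pow]
            congr 2 <;> ring
        _ = g ^ ((b x * a y + b y * a x) * a (x * y)) := by
            rw [hpow, hpow, ← zpow_add]
            congr 1
            push_cast
            ring
    have h' : (b (x * y) : ℚ) * (a x * a y) = (b x * a y + b y * a x) * a (x * y) := by
      exact_mod_cast h
    rw [div_add_div _ _ (ha' x) (ha' y), div_eq_div_iff (ha' _) (mul_ne_zero (ha' x) (ha' y))]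
    linear_combination h'
  let φ : Additive A →+ ℚ :=
    AddMonoidHom.mk' (fun x ↦ (b x.toMul : ℚ) / a x.toMul) fun x y ↦ hadd x.toMul y.toMul
  refine ⟨φ, (injective_iff_map_eq_zero φ).2 fun x hx ↦ ?_⟩
  have hb : b x.toMul = 0 := by
    have : (b x.toMul : ℚ) / a x.toMul = 0 := hx
    simpa [ha'] using this
  have hx1 := hab x.toMul
  rw [hb, zpow_zero] at hx1
  exact htf _ (isOfFinOrder_iff_pow_eq_one.2 ⟨_, ha _, hx1⟩)

theorem isAbelianOfRankOne_of_injective_rat {A : Type u} [Group A]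
    (hA : ∀ x y : A, x * y = y * x) {g : A} (hg : ¬ IsOfFinOrder g)
    {φ : Additive A →+ ℚ} (hφ : Function.Injective φ) : IsAbelianOfRankOne A := by
  refine ⟨hA, ?_⟩
  let _ : CommGroup A := { mul_comm := hA }
  apply le_antisymm
  · have h := LinearMap.lift_rank_le_of_injective φ.toIntLinearMap hφ
    rw [← IsLocalization.rank_eq (N := ℚ) ℚ (nonZeroDivisors ℤ) le_rfl, Module.rank_self] at h
    simpa using h
  · refine Module.one_le_rank_iff.2 ⟨LinearMap.toSpanSingleton ℤ _ (Additive.ofMul g), ?_⟩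
    exact injective_zpow_iff_not_isOfFinOrder (x := g).2 hg

theorem mainTheorem11 {G : Type u} [Group G] (hG : IsLacunaryHyperbolic G)
    (htf : ∀ x : G, IsOfFinOrder x → x = 1) (g : G) (hg : ¬ IsOfFinOrder g) :
    IsAbelianOfRankOne (elementarySubgroup g) ∧
      ∃ φ : Additive (elementarySubgroup g) →+ ℚ, Function.Injective φ := by
  have key : ∀ x y : elementarySubgroup g, Commute (x : G) y ∧
      ∃ a : ℕ, 0 < a ∧ ∃ b : ℤ, (x : G) ^ a = g ^ b := by
    intro x y
    obtain ⟨n, hn, hx⟩ := hG.commute_of_mem_elementarySubgroup htf hg x.2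
    obtain ⟨m, hm, hy⟩ := hG.commute_of_mem_elementarySubgroup htf hg y.2
    refine hG.commute_and_exists_pow_eq_zpow htf hg (Nat.mul_pos hn hm) ?_ ?_
    · rw [pow_mul]
      exact hx.pow_right m
    · rw [mul_comm, pow_mul]
      exact hy.pow_right n
  have hcomm : ∀ x y : elementarySubgroup g, x * y = y * x := fun x y ↦
    Subtype.ext (key x y).1.eq
  let g' : elementarySubgroup g := ⟨g, 1, one_pos, Or.inl (by simp)⟩
  have hg' : ¬ IsOfFinOrder g' := fun h ↦ hg (Submonoid.isOfFinOrder_coe.2 h)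
  obtain ⟨φ, hφ⟩ := exists_injective_addMonoidHom_rat hcomm
    (fun x hx ↦ Subtype.ext (htf _ (Submonoid.isOfFinOrder_coe.2 hx))) hg'
    (fun x ↦ by
      obtain ⟨a, ha, b, hab⟩ := (key x x).2
      exact ⟨a, ha, b, Subtype.ext (by simpa [g'] using hab)⟩)
  exact ⟨isAbelianOfRankOne_of_injective_rat hcomm hg' hφ, φ, hφ⟩
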